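/- Let $d\ge 2$ be an integer and $\alpha\in(0,1)$. There is a constant $C=C(\alpha,d)>0$ such that for every set $E\subset\mathbb{R}^d$ of finite perimeter $$\|\mathcal{D}^{1-\alpha}(\chi_E)\|_{L^{d/(d-\alpha),1}(\mathbb{R}^d)}\le C\,\mathrm{Per}(E)^{1-\alpha}\,|E|^{\alpha(1-1/d)}.$$ Here $|E|$ is the Lebesgue measure of $E$, $\chi_E$ is its characteristic function, and $$\mathcal{D}^{1-\alpha}(u)(x)=\int_{\mathbb{R}^d}\frac{|u(x)-u(y)|}{|x-y|^{d+1-\alpha}}\,dy\in[0,\infty].$$ The set $E$ has finite perimeter if it is Lebesgue measurable, $|E|<\infty$, and $$\mathrm{Per}(E)=\sup\Big\{\Big|\int_{\mathbb{R}^d}\chi_E\,\operatorname{div}\Phi\,dx\Big| : \Phi\in C^1_c(\mathbb{R}^d;\mathbb{R}^d),\ \|\Phi\|_{L^\infty}\le 1\Big\}<\infty .$$ For $1<q<\infty$ the Lorentz norm is $$\|f\|_{L^{q,1}(\mathbb{R}^d)}=\int_0^\infty t^{1/q}f^{**}(t)\,\frac{dt}{t},\qquad f^{**}(t)=\frac1t\int_0^t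 f^*(s)\,ds,$$ where $f^*(t)=\inf\{y\ge 0: |\{|f|>y\}|<t\}$, $t>0$, is the left-continuous non-increasing rearrangement of $f$. -/

import Mathlib

open MeasureTheory Set
open scoped ENNReal NNReal

noncomputable section

namespace FracPerimeter

/-- The divergence `∑ i, ∂ᵢ Φᵢ` of a vector field on `ℝ^d`. -/
def divergence {d : ℕ} (Φ : EuclideanSpace ℝ (Fin d) → EuclideanSpace ℝ (Fin d))
    (x : EuclideanSpace ℝ (Fin d)) : ℝ :=
  ∑ i : Fin d, (fderiv ℝ Φ x (EuclideanSpace.single i 1)) i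

/-- The competitors in the definition of the total variation: `C¹` compactly supported vector
fields with sup norm (with respect to the Euclidean norm) at most one. -/
def testFields (d : ℕ) : Set (EuclideanSpace ℝ (Fin d) → EuclideanSpace ℝ (Fin d)) :=
  {Φ | ContDiff ℝ 1 Φ ∧ HasCompactSupport Φ ∧ ∀ x, ‖Φ x‖ ≤ 1}

/-- The total variation `|Du|(ℝ^d) = sup_Φ |∫ u div Φ|`, as an extended nonnegative number. -/
def totalVariation {d : ℕ} (u : EuclideanSpace ℝ (Fin d) → ℝ) : ℝ≥0∞ :=
  ⨆ Φ ∈ testFields d, ENNReal.ofReal |∫ x, u x * divergence Φ x|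

/-- `u ∈ BV(ℝ^d)`: `u` is in `L¹` and has finite total variation. -/
def IsBV {d : ℕ} (u : EuclideanSpace ℝ (Fin d) → ℝ) : Prop :=
  Integrable u ∧ totalVariation u < ∞

/-- The characteristic function of a set. -/
def chi {d : ℕ} (E : Set (EuclideanSpace ℝ (Fin d))) : EuclideanSpace ℝ (Fin d) → ℝ :=
  E.indicator fun _ => 1

/-- `E` has finite perimeter: `|E| < ∞` and `χ_E ∈ BV(ℝ^d)`. (The integrability of `χ_E` contains
the Lebesgue measurability of `E`.) -/
def HasFinitePerimeter {d : ℕ} (E : Set (EuclideanSpace ℝ (Fin d))) : Prop :=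
  volume E < ∞ ∧ IsBV (chi E)

/-- `Per(E) = |Dχ_E|(ℝ^d)`. -/
def perimeter {d : ℕ} (E : Set (EuclideanSpace ℝ (Fin d))) : ℝ≥0∞ :=
  totalVariation (chi E)

/-- The nonlinear fractional derivative of order `s`,
`𝒟^s(u)(x) = ∫ |u(x) - u(y)| / |x - y|^(d + s) dy ∈ [0, ∞]`. -/
def fracDeriv {d : ℕ} (s : ℝ) (u : EuclideanSpace ℝ (Fin d) → ℝ)
    (x : EuclideanSpace ℝ (Fin d)) : ℝ≥0∞ :=
  ∫⁻ y, ENNReal.ofReal (|u x - u y| / ‖x - y‖ ^ ((d : ℝ) + s))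

/-- The distribution function `m(f, y) = |{f > y}|` of a nonnegative function. -/
def distribution {d : ℕ} (f : EuclideanSpace ℝ (Fin d) → ℝ≥0∞) (y : ℝ≥0∞) : ℝ≥0∞ :=
  volume {x | y < f x}

/-- The non-increasing rearrangement `f^*` on `(0, ∞)`: the left-continuous inverse
`f^*(t) = inf {y ≥ 0 : m(f, y) < t}` of the distribution function. -/
def rearrangement {d : ℕ} (f : EuclideanSpace ℝ (Fin d) → ℝ≥0∞) (t : ℝ) : ℝ≥0∞ :=
  sInf {y | distribution f y < ENNReal.ofReal t}

/-- `f^{**}(t) = (1/t) ∫_0^t f^*(s) ds` for `t > 0`. -/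
def averagedRearrangement {d : ℕ} (f : EuclideanSpace ℝ (Fin d) → ℝ≥0∞) (t : ℝ) : ℝ≥0∞ :=
  (∫⁻ s in Ioc 0 t, rearrangement f s) / ENNReal.ofReal t

/-- The Lorentz norm `‖f‖_{L^{q,r}} = (∫_0^∞ [t^{1/q} f^{**}(t)]^r dt/t)^{1/r}` of a
nonnegative function, for `1 < q < ∞` and `1 ≤ r < ∞`. -/
def lorentzNorm {d : ℕ} (q r : ℝ) (f : EuclideanSpace ℝ (Fin d) → ℝ≥0∞) : ℝ≥0∞ :=
  (∫⁻ t in Ioi (0 : ℝ),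
    (ENNReal.ofReal t ^ (1 / q) * averagedRearrangement f t) ^ r / ENNReal.ofReal t) ^ (1 / r)

end FracPerimeter

end

/-!
Fix `u ∈ BV(ℝ^d)`, `s = 1 - α`, and split the singular integral `𝒟^s(u)` at radius `r`. Since
`‖u(· + h) - u‖₁ ≤ |h| |Du|`, the near part has `L¹` norm `≲ |Du| r^α`; the far part is
`≲ r^(-s) ‖u‖_p` in `L^p` for both `p = 1` and `p = ∞`. As `∫₀ᵗ f^*` is subadditive and at most
`min(t ‖f‖_∞, ‖f‖₁)`, this gives
`∫₀ᵗ 𝒟^s(u)^* ≲ |Du| r^α + r^(-s) min(t ‖u‖_∞, ‖u‖₁)`,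
and optimising in `r` gives `∫₀ᵗ 𝒟^s(u)^* ≲ |Du|^(1-α) min(t ‖u‖_∞, ‖u‖₁)^α`. Integrating against
`t^(1/q - 2)` with `1 - 1/q = α/d < α` bounds the Lorentz norm by
`|Du|^(1-α) ‖u‖₁^(α(1-1/d)) ‖u‖_∞^(α/d)`, which for `u = χ_E` is the claim.
-/

open Filter Topology

namespace FracPerimeter

section Rearrangement

variable {d : ℕ} {f g : EuclideanSpace ℝ (Fin d) → ℝ≥0∞}

theorem rearrangement_antitone (f : EuclideanSpace ℝ (Fin d) → ℝ≥0∞) :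
    Antitone (rearrangement f) := fun _ _ hst ↦
  sInf_le_sInf fun _ hy ↦ lt_of_lt_of_le hy (ENNReal.ofReal_le_ofReal hst)

theorem lt_rearrangement_imp_ofReal_le_distribution {y : ℝ≥0∞} {t : ℝ}
    (h : y < rearrangement f t) : ENNReal.ofReal t ≤ distribution f y :=
  not_lt.1 fun hy ↦ h.not_ge (sInf_le hy)

theorem rearrangement_le_add_const {M : ℝ≥0∞} (h : ∀ᵐ x, f x ≤ g x + M) (t : ℝ) :
    rearrangement f t ≤ rearrangement g t + M := by
  rw [rearrangement, rearrangement, ENNReal.sInf_add]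
  refine le_iInf₂ fun y hy ↦ sInf_le (lt_of_le_of_lt (measure_mono_ae ?_) hy)
  filter_upwards [h] with x hx (hxy : y + M < f x)
  exact lt_of_add_lt_add_right (hxy.trans_le hx)

theorem volume_restrict_Ioi_setOf_ofReal_lt (a : ℝ≥0∞) :
    volume.restrict (Ioi (0 : ℝ)) {y | ENNReal.ofReal y < a} = a := by
  rw [Measure.restrict_apply (measurableSet_lt ENNReal.measurable_ofReal measurable_const)]
  induction a with
  | top => simp
  | coe a =>
    have : {y : ℝ | ENNReal.ofReal y < a} ∩ Ioi 0 = Ioo 0 (a : ℝ) := by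
      ext y
      simp only [mem_inter_iff, mem_ofPred_eq, mem_Ioi, mem_Ioo, and_comm (b := 0 < y)]
      refine and_congr_right fun hy ↦ ?_
      rw [ENNReal.ofReal_lt_iff_lt_toReal hy.le ENNReal.coe_ne_top, ENNReal.coe_toReal]
    rw [this, Real.volume_Ioo, sub_zero, ENNReal.ofReal_coe_nnreal]

theorem volume_restrict_Ioi_setOf_ofReal_le (a : ℝ≥0∞) :
    volume.restrict (Ioi (0 : ℝ)) {y | ENNReal.ofReal y ≤ a} ≤ a := by
  rw [Measure.restrict_apply (measurableSet_le ENNReal.measurable_ofReal measurable_const)]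
  induction a with
  | top => exact le_top
  | coe a =>
    calc _ ≤ volume (Ioc 0 (a : ℝ)) := measure_mono fun y hy ↦ ⟨hy.2, by simpa using hy.1⟩
      _ = a := by simp

theorem lintegral_eq_lintegral_measure_ofReal_lt {X : Type*} [MeasurableSpace X] (μ : Measure X)
    [SFinite μ] {f : X → ℝ≥0∞} (hf : AEMeasurable f μ) :
    ∫⁻ x, f x ∂μ = ∫⁻ y in Ioi (0 : ℝ), μ {x | ENNReal.ofReal y < f x} := by
  wlog hm : Measurable f generalizing f
  · rw [lintegral_congr_ae hf.ae_eq_mk, this hf.measurable_mk.aemeasurable hf.measurable_mk]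
    refine lintegral_congr fun y ↦ measure_congr ?_
    filter_upwards [hf.ae_eq_mk] with x hx
    exact congrArg (ENNReal.ofReal y < ·) hx.symm
  have hlt : MeasurableSet {p : X × ℝ | ENNReal.ofReal p.2 < f p.1} :=
    measurableSet_lt (by fun_prop) (by fun_prop)
  calc ∫⁻ x, f x ∂μ
      = ∫⁻ x, volume.restrict (Ioi (0 : ℝ)) {y | ENNReal.ofReal y < f x} ∂μ := by
        simp only [volume_restrict_Ioi_setOf_ofReal_lt]
    _ = (μ.prod (volume.restrict (Ioi 0))) {p | ENNReal.ofReal p.2 < f p.1} :=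
        (Measure.prod_apply hlt).symm
    _ = ∫⁻ y in Ioi (0 : ℝ), μ {x | ENNReal.ofReal y < f x} := Measure.prod_apply_symm hlt

theorem lintegral_rearrangement_le (hf : AEMeasurable f) :
    ∫⁻ s in Ioi (0 : ℝ), rearrangement f s ≤ ∫⁻ x, f x := by
  rw [lintegral_eq_lintegral_measure_ofReal_lt _ (rearrangement_antitone f).measurable.aemeasurable,
    lintegral_eq_lintegral_measure_ofReal_lt _ hf]
  exact lintegral_mono fun y ↦
    (measure_mono fun _ ↦ lt_rearrangement_imp_ofReal_le_distribution).trans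
      (volume_restrict_Ioi_setOf_ofReal_le (distribution f (ENNReal.ofReal y)))

/-- The elementary half of the identity between `∫₀ᵗ f^*` and the `K`-functional of the couple
`(L¹, L^∞)`. -/
theorem lintegral_rearrangement_le_add (hg : AEMeasurable g) {M : ℝ≥0∞}
    (h : ∀ᵐ x, f x ≤ g x + M) (t : ℝ) :
    ∫⁻ s in Ioc 0 t, rearrangement f s ≤ (∫⁻ x, g x) + M * ENNReal.ofReal t :=
  calc ∫⁻ s in Ioc 0 t, rearrangement f s
      ≤ ∫⁻ s in Ioc 0 t, (rearrangement g s + M) :=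
        lintegral_mono fun s ↦ rearrangement_le_add_const h s
    _ = (∫⁻ s in Ioc 0 t, rearrangement g s) + M * ENNReal.ofReal t := by
        rw [lintegral_add_right _ measurable_const, setLIntegral_const, Real.volume_Ioc, sub_zero]
    _ ≤ (∫⁻ x, g x) + M * ENNReal.ofReal t := by
        gcongr
        exact (lintegral_mono_set Ioc_subset_Ioi_self).trans (lintegral_rearrangement_le hg)

end Rearrangement

section Powers

theorem setLIntegral_Ioc_rpow_sub_one {a v : ℝ} (ha : 0 < a) (hv : 0 < v) :
    ∫⁻ t in Ioc 0 v, ENNReal.ofReal (t ^ (a - 1)) = ENNReal.ofReal (v ^ a / a) := by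
  have hint : IntegrableOn (fun t : ℝ ↦ t ^ (a - 1)) (Ioc 0 v) :=
    (intervalIntegrable_iff_integrableOn_Ioc_of_le hv.le).1
      (intervalIntegral.intervalIntegrable_rpow' (by linarith))
  have hnonneg : ∀ᵐ t ∂volume.restrict (Ioc 0 v), 0 ≤ t ^ (a - 1) :=
    (ae_restrict_mem measurableSet_Ioc).mono fun t ht ↦ Real.rpow_nonneg ht.1.le _
  rw [← ofReal_integral_eq_lintegral_ofReal hint hnonneg,
    ← intervalIntegral.integral_of_le hv.le, integral_rpow (Or.inl (by linarith)), sub_add_cancel,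
    Real.zero_rpow ha.ne', sub_zero]

theorem setLIntegral_Ioi_rpow_neg_sub_one {a v : ℝ} (ha : 0 < a) (hv : 0 < v) :
    ∫⁻ t in Ioi v, ENNReal.ofReal (t ^ (-a - 1)) = ENNReal.ofReal (v ^ (-a) / a) := by
  have hint : IntegrableOn (fun t : ℝ ↦ t ^ (-a - 1)) (Ioi v) :=
    integrableOn_Ioi_rpow_of_lt (by linarith) hv
  have hnonneg : ∀ᵐ t ∂volume.restrict (Ioi v), 0 ≤ t ^ (-a - 1) :=
    (ae_restrict_mem measurableSet_Ioi).mono fun t ht ↦ Real.rpow_nonneg (hv.trans ht).le _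
  rw [← ofReal_integral_eq_lintegral_ofReal hint hnonneg,
    integral_Ioi_rpow_of_lt (by linarith) hv, sub_add_cancel, neg_div_neg_eq]

variable {V : Type*} [NormedAddCommGroup V] [NormedSpace ℝ V] [FiniteDimensional ℝ V]
  [Nontrivial V] [MeasurableSpace V] [BorelSpace V] (μ : Measure V) [μ.IsAddHaarMeasure]

theorem lintegral_fun_norm_addHaar {f : ℝ → ℝ≥0∞} (hf : Measurable f) :
    ∫⁻ x, f ‖x‖ ∂μ = μ.toSphere univ *
      ∫⁻ y in Ioi (0 : ℝ), ENNReal.ofReal (y ^ (Module.finrank ℝ V - 1)) * f y := by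
  calc ∫⁻ x, f ‖x‖ ∂μ
      = ∫⁻ x : ({0}ᶜ : Set V), f ‖x.1‖ ∂μ.comap (↑) := by
        rw [lintegral_subtype_comap (measurableSet_singleton _).compl fun x ↦ f ‖x‖,
          restrict_compl_singleton]
    _ = ∫⁻ p, f p.2 ∂μ.toSphere.prod (.volumeIoiPow (Module.finrank ℝ V - 1)) := by
        simpa using μ.measurePreserving_homeomorphUnitSphereProd.lintegral_comp_emb
          (Homeomorph.measurableEmbedding _) (f ∘ Subtype.val ∘ Prod.snd)
    _ = μ.toSphere univ * ∫⁻ y, f y ∂.volumeIoiPow (Module.finrank ℝ V - 1) := by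
        rw [lintegral_prod _ (by fun_prop)]
        simp only [lintegral_const, mul_comm]
    _ = _ := by
        rw [Measure.volumeIoiPow, lintegral_withDensity_eq_lintegral_mul _ (by fun_prop)
          (by fun_prop)]
        congr 1
        exact lintegral_subtype_comap measurableSet_Ioi
          fun y ↦ ENNReal.ofReal (y ^ (Module.finrank ℝ V - 1)) * f y

theorem setLIntegral_preimage_norm_rpow {T : Set ℝ} (hT : MeasurableSet T) (a : ℝ) :
    ∫⁻ x in norm ⁻¹' T, ENNReal.ofReal (‖x‖ ^ a) ∂μ = μ.toSphere univ *
      ∫⁻ y in T ∩ Ioi 0, ENNReal.ofReal (y ^ ((Module.finrank ℝ V : ℝ) - 1 + a)) := by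
  have hpow : ∀ y ∈ Ioi (0 : ℝ), ENNReal.ofReal (y ^ (Module.finrank ℝ V - 1)) *
      T.indicator (fun y ↦ ENNReal.ofReal (y ^ a)) y =
        T.indicator (fun y ↦ ENNReal.ofReal (y ^ ((Module.finrank ℝ V : ℝ) - 1 + a))) y := by
    intro y (hy : 0 < y)
    by_cases hyT : y ∈ T
    · rw [indicator_of_mem hyT, indicator_of_mem hyT, ← ENNReal.ofReal_mul (by positivity),
        Real.rpow_add hy, ← Real.rpow_natCast, Nat.cast_pred Module.finrank_pos]
    · rw [indicator_of_notMem hyT, indicator_of_notMem hyT, mul_zero]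
  calc ∫⁻ x in norm ⁻¹' T, ENNReal.ofReal (‖x‖ ^ a) ∂μ
      = ∫⁻ x, T.indicator (fun y ↦ ENNReal.ofReal (y ^ a)) ‖x‖ ∂μ :=
        (lintegral_indicator (measurable_norm hT) _).symm
    _ = _ := by
        rw [lintegral_fun_norm_addHaar μ ((by fun_prop : Measurable _).indicator hT),
          setLIntegral_congr_fun measurableSet_Ioi hpow, setLIntegral_indicator hT]

theorem setLIntegral_closedBall_norm_rpow {a r : ℝ} (ha : 0 < a) (hr : 0 < r) :
    ∫⁻ x in Metric.closedBall 0 r, ENNReal.ofReal (‖x‖ ^ (a - Module.finrank ℝ V)) ∂μ =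
      μ.toSphere univ * ENNReal.ofReal (r ^ a / a) := by
  have hball : Metric.closedBall (0 : V) r = norm ⁻¹' Iic r := by ext; simp
  rw [hball, setLIntegral_preimage_norm_rpow μ measurableSet_Iic, inter_comm, Ioi_inter_Iic,
    ← setLIntegral_Ioc_rpow_sub_one ha hr]
  ring_nf

theorem setLIntegral_compl_closedBall_norm_rpow {a r : ℝ} (ha : 0 < a) (hr : 0 < r) :
    ∫⁻ x in (Metric.closedBall 0 r)ᶜ, ENNReal.ofReal (‖x‖ ^ (-(Module.finrank ℝ V + a))) ∂μ =
      μ.toSphere univ * ENNReal.ofReal (r ^ (-a) / a) := by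
  have hball : (Metric.closedBall (0 : V) r)ᶜ = norm ⁻¹' Ioi r := by ext; simp
  rw [hball, setLIntegral_preimage_norm_rpow μ measurableSet_Ioi, Ioi_inter_Ioi,
    sup_of_le_left hr.le, ← setLIntegral_Ioi_rpow_neg_sub_one ha hr]
  ring_nf

end Powers

section TotalVariation

open scoped ContDiff

theorem abs_sub_mul_div_sqrt_le {δ : ℝ} (hδ : 0 < δ) (y : ℝ) :
    |y| - y * (y / √(y ^ 2 + δ ^ 2)) ≤ δ := by
  have hpos : 0 < √(y ^ 2 + δ ^ 2) := by positivity
  have hle : √(y ^ 2 + δ ^ 2) ≤ |y| + δ := by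
    rw [Real.sqrt_le_left (by positivity), ← sq_abs y]
    nlinarith [abs_nonneg y]
  have hge : |y| ≤ √(y ^ 2 + δ ^ 2) := Real.abs_le_sqrt (by nlinarith)
  calc |y| - y * (y / √(y ^ 2 + δ ^ 2))
      = |y| / √(y ^ 2 + δ ^ 2) * (√(y ^ 2 + δ ^ 2) - |y|) := by
        field_simp
        linear_combination sq_abs y
    _ ≤ 1 * δ := by
        gcongr
        · exact div_le_one_of_le₀ hge hpos.le
        · linarith
    _ = δ := one_mul δ

theorem enorm_integral_mul_le_lintegral_enorm {X : Type*} [MeasurableSpace X] {μ : Measure X}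
    (f : X → ℝ) {φ : X → ℝ} (hφ : ∀ x, |φ x| ≤ 1) :
    ‖∫ x, f x * φ x ∂μ‖ₑ ≤ ∫⁻ x, ‖f x‖ₑ ∂μ := by
  refine (enorm_integral_le_lintegral_enorm _).trans (lintegral_mono fun x ↦ ?_)
  rw [enorm_mul]
  exact mul_le_of_le_one_right' (by simpa [← ofReal_norm] using hφ x)

theorem enorm_integral_mul_le_add_lintegral_enorm_sub {X : Type*} [MeasurableSpace X]
    {μ : Measure X} {f g φ : X → ℝ} (hf : Integrable f μ) (hg : Integrable g μ)
    (hφ : AEStronglyMeasurable φ μ) (hφ₁ : ∀ x, |φ x| ≤ 1) :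
    ‖∫ x, g x * φ x ∂μ‖ₑ ≤ ‖∫ x, f x * φ x ∂μ‖ₑ + ∫⁻ x, ‖(f - g) x‖ₑ ∂μ := by
  have hbdd : ∀ {k : X → ℝ}, Integrable k μ → Integrable (fun x ↦ k x * φ x) μ := fun hk ↦
    hk.mul_bdd (c := 1) hφ (.of_forall hφ₁)
  calc ‖∫ x, g x * φ x ∂μ‖ₑ
      = ‖∫ x, f x * φ x ∂μ - ∫ x, (f - g) x * φ x ∂μ‖ₑ := by
        rw [← integral_sub (hbdd hf) (hbdd (hf.sub hg))]
        simp [sub_mul]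
    _ ≤ ‖∫ x, f x * φ x ∂μ‖ₑ + ‖∫ x, (f - g) x * φ x ∂μ‖ₑ := enorm_sub_le
    _ ≤ ‖∫ x, f x * φ x ∂μ‖ₑ + ∫⁻ x, ‖(f - g) x‖ₑ ∂μ := by
        gcongr
        exact enorm_integral_mul_le_lintegral_enorm (f - g) hφ₁

variable {V : Type*} [NormedAddCommGroup V] [NormedSpace ℝ V] [MeasurableSpace V]
  [BorelSpace V] {μ : Measure V} [IsFiniteMeasureOnCompacts μ]

/-- A smooth substitute for `φ = sign g` is `φ = g / √(g² + δ²)` with small `δ`. -/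
theorem exists_contDiff_integral_abs_le_integral_mul_add {g : V → ℝ} (hg : ContDiff ℝ ∞ g)
    (hc : HasCompactSupport g) {ε : ℝ} (hε : 0 < ε) :
    ∃ φ : V → ℝ, ContDiff ℝ ∞ φ ∧ HasCompactSupport φ ∧ (∀ x, |φ x| ≤ 1) ∧
      ∫ x, |g x| ∂μ ≤ ∫ x, g x * φ x ∂μ + ε := by
  set K := tsupport g
  obtain ⟨δ, hδ, hδε⟩ : ∃ δ > 0, δ * μ.real K ≤ ε :=
    ⟨ε / (μ.real K + 1), by positivity, by
      rw [div_mul_eq_mul_div, div_le_iff₀ (by positivity)]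
      nlinarith⟩
  have hpos : ∀ x, 0 < g x ^ 2 + δ ^ 2 := fun x ↦ by positivity
  set φ : V → ℝ := fun x ↦ g x / √(g x ^ 2 + δ ^ 2)
  have hφ : ContDiff ℝ ∞ φ :=
    hg.div (((hg.pow 2).add contDiff_const).sqrt fun x ↦ (hpos x).ne')
      fun x ↦ (Real.sqrt_pos.2 (hpos x)).ne'
  have hgi : Integrable g μ := hg.continuous.integrable_of_hasCompactSupport hc
  have hgφi : Integrable (fun x ↦ g x * φ x) μ :=
    (hg.continuous.mul hφ.continuous).integrable_of_hasCompactSupport hc.mul_right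
  refine ⟨φ, hφ, hc.mono fun x hx ↦ left_ne_zero_of_mul hx, fun x ↦ ?_, ?_⟩
  · rw [abs_div, abs_of_nonneg (Real.sqrt_nonneg _)]
    exact div_le_one_of_le₀ (Real.abs_le_sqrt (by nlinarith)) (Real.sqrt_nonneg _)
  have hdiff : ∀ x, |g x| - g x * φ x ≤ K.indicator (fun _ ↦ δ) x := by
    intro x
    by_cases hx : x ∈ K
    · rw [indicator_of_mem hx]
      exact abs_sub_mul_div_sqrt_le hδ (g x)
    · simp [image_eq_zero_of_notMem_tsupport hx, hx]
  have hKi : Integrable (K.indicator fun _ ↦ δ) μ :=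
    (integrable_indicator_iff (isClosed_tsupport g).measurableSet).2
      (integrableOn_const hc.measure_ne_top)
  calc ∫ x, |g x| ∂μ = ∫ x, g x * φ x ∂μ + ∫ x, (|g x| - g x * φ x) ∂μ := by
        rw [integral_sub hgi.abs hgφi]; ring
    _ ≤ ∫ x, g x * φ x ∂μ + ∫ x, K.indicator (fun _ ↦ δ) x ∂μ :=
        add_le_add_right (integral_mono (hgi.abs.sub hgφi) hKi hdiff) _
    _ ≤ ∫ x, g x * φ x ∂μ + ε := by
        rw [integral_indicator_const _ (isClosed_tsupport g).measurableSet, smul_eq_mul, mul_comm]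
        gcongr

theorem lintegral_enorm_le_of_forall_enorm_integral_mul_le [FiniteDimensional ℝ V] {f : V → ℝ}
    (hf : Integrable f μ) {M : ℝ≥0∞}
    (hM : ∀ φ : V → ℝ, ContDiff ℝ ∞ φ → HasCompactSupport φ → (∀ x, |φ x| ≤ 1) →
      ‖∫ x, f x * φ x ∂μ‖ₑ ≤ M) :
    ∫⁻ x, ‖f x‖ₑ ∂μ ≤ M := by
  refine ENNReal.le_of_forall_pos_le_add fun ε hε _ ↦ ?_
  have hε3 : 0 < (ε / 3 : ℝ) := by positivity
  obtain ⟨g, hgc, hg, hfg⟩ := (memLp_one_iff_integrable.2 hf).exist_eLpNorm_sub_le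
    ENNReal.one_ne_top le_rfl hε3
  rw [eLpNorm_one_eq_lintegral_enorm] at hfg
  obtain ⟨φ, hφ, hφc, hφ1, hgφ⟩ := exists_contDiff_integral_abs_le_integral_mul_add (μ := μ)
    hg hgc hε3
  have hgi : Integrable g μ := hg.continuous.integrable_of_hasCompactSupport hgc
  have hg_le : ∫⁻ x, ‖g x‖ₑ ∂μ ≤ ‖∫ x, g x * φ x ∂μ‖ₑ + ENNReal.ofReal (ε / 3) := by
    rw [← ofReal_integral_norm_eq_lintegral_enorm hgi, ← ofReal_norm,
      ← ENNReal.ofReal_add (norm_nonneg _) hε3.le]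
    exact ENNReal.ofReal_le_ofReal (hgφ.trans (by gcongr; exact Real.le_norm_self _))
  have hgφ_le : ‖∫ x, g x * φ x ∂μ‖ₑ ≤ M + ENNReal.ofReal (ε / 3) :=
    (enorm_integral_mul_le_add_lintegral_enorm_sub hf hgi hφ.continuous.aestronglyMeasurable
      hφ1).trans (add_le_add (hM φ hφ hφc hφ1) hfg)
  calc ∫⁻ x, ‖f x‖ₑ ∂μ
      ≤ ∫⁻ x, (‖(f - g) x‖ₑ + ‖g x‖ₑ) ∂μ := by
        refine lintegral_mono fun x ↦ ?_
        simpa using enorm_add_le (f x - g x) (g x)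
    _ = ∫⁻ x, ‖(f - g) x‖ₑ ∂μ + ∫⁻ x, ‖g x‖ₑ ∂μ := lintegral_add_right' _ hgi.1.enorm
    _ ≤ ENNReal.ofReal (ε / 3) + (M + ENNReal.ofReal (ε / 3) + ENNReal.ofReal (ε / 3)) := by
        gcongr
        exact hg_le.trans (by gcongr)
    _ = M + ε := by
        rw [← ENNReal.ofReal_coe_nnreal (p := ε),
          show (ε : ℝ) = ε / 3 + (ε / 3 + ε / 3) by ring,
          ENNReal.ofReal_add hε3.le (by positivity), ENNReal.ofReal_add hε3.le hε3.le]
        ring_nf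

variable {d : ℕ} {u : EuclideanSpace ℝ (Fin d) → ℝ}

theorem enorm_integral_mul_divergence_le
    {Φ : EuclideanSpace ℝ (Fin d) → EuclideanSpace ℝ (Fin d)} (hΦ : Φ ∈ testFields d) :
    ‖∫ x, u x * divergence Φ x‖ₑ ≤ totalVariation u := by
  rw [Real.enorm_eq_ofReal_abs]
  exact le_iSup₂ (f := fun Φ (_ : Φ ∈ testFields d) ↦
    ENNReal.ofReal |∫ x, u x * divergence Φ x|) Φ hΦ

theorem divergence_smul_const {φ : EuclideanSpace ℝ (Fin d) → ℝ} {x : EuclideanSpace ℝ (Fin d)}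
    (hφ : DifferentiableAt ℝ φ x) (v : EuclideanSpace ℝ (Fin d)) :
    divergence (fun x ↦ φ x • v) x = fderiv ℝ φ x v := by
  have hv : ∑ i, v i • EuclideanSpace.single i (1 : ℝ) = v := by
    simpa using (EuclideanSpace.basisFun (Fin d) ℝ).sum_repr v
  conv_rhs => rw [← hv, map_sum]
  simp [divergence, fderiv_smul_const hφ v, mul_comm]

theorem enorm_integral_mul_fderiv_le {φ : EuclideanSpace ℝ (Fin d) → ℝ} (hφ : ContDiff ℝ 1 φ)
    (hc : HasCompactSupport φ) (h1 : ∀ x, |φ x| ≤ 1) (v : EuclideanSpace ℝ (Fin d)) :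
    ‖∫ x, u x * fderiv ℝ φ x v‖ₑ ≤ ‖v‖ₑ * totalVariation u := by
  rcases eq_or_ne v 0 with rfl | hv
  · simp
  have hv' : ‖v‖ ≠ 0 := norm_ne_zero_iff.2 hv
  set w := ‖v‖⁻¹ • v
  have hw : ‖w‖ = 1 := by rw [norm_smul, norm_inv, norm_norm, inv_mul_cancel₀ hv']
  have hmem : (fun x ↦ φ x • w) ∈ testFields d :=
    ⟨hφ.smul contDiff_const, hc.smul_right, fun x ↦ by
      rw [norm_smul, hw, mul_one]
      exact h1 x⟩
  have hvw : v = ‖v‖ • w := (smul_inv_smul₀ hv' v).symm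
  have hdiv : ∀ x, u x * fderiv ℝ φ x v = ‖v‖ * (u x * divergence (fun x ↦ φ x • w) x) := by
    intro x
    rw [divergence_smul_const (hφ.differentiable one_ne_zero x)]
    conv_lhs => rw [hvw, map_smul, smul_eq_mul]
    ring
  simp_rw [hdiv, integral_const_mul, enorm_mul, enorm_norm]
  gcongr
  exact enorm_integral_mul_divergence_le hmem

theorem sub_eq_setIntegral_fderiv {V : Type*} [NormedAddCommGroup V] [NormedSpace ℝ V] {φ : V → ℝ}
    (hφ : ContDiff ℝ 1 φ) (x v : V) :
    φ (x + v) - φ x = ∫ s in Ioc (0 : ℝ) 1, fderiv ℝ φ (x + s • v) v := by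
  have hderiv : ∀ s : ℝ, HasDerivAt (fun s : ℝ ↦ φ (x + s • v)) (fderiv ℝ φ (x + s • v) v) s := by
    intro s
    have hline : HasDerivAt (fun s : ℝ ↦ x + s • v) v s := by
      simpa using ((hasDerivAt_id s).smul_const v).const_add x
    exact (hφ.differentiable one_ne_zero _).hasFDerivAt.comp_hasDerivAt s hline
  have hcont : Continuous fun s : ℝ ↦ fderiv ℝ φ (x + s • v) v :=
    ((hφ.continuous_fderiv one_ne_zero).comp (by fun_prop)).clm_apply continuous_const
  rw [← intervalIntegral.integral_of_le zero_le_one,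
    intervalIntegral.integral_eq_sub_of_hasDerivAt (fun s _ ↦ hderiv s)
      (hcont.intervalIntegrable _ _)]
  simp

theorem enorm_integral_mul_translate_sub_le (hu : Integrable u)
    {φ : EuclideanSpace ℝ (Fin d) → ℝ} (hφ : ContDiff ℝ 1 φ) (hc : HasCompactSupport φ)
    (h1 : ∀ x, |φ x| ≤ 1) (v : EuclideanSpace ℝ (Fin d)) :
    ‖∫ x, u x * (φ (x + v) - φ x)‖ₑ ≤ ‖v‖ₑ * totalVariation u := by
  have hdc : Continuous (fderiv ℝ φ) := hφ.continuous_fderiv one_ne_zero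
  obtain ⟨B, hB⟩ : ∃ B, ∀ x, ‖fderiv ℝ φ x‖ ≤ B :=
    hdc.bounded_above_of_compact_support (hc.fderiv ℝ)
  have hint : Integrable (fun p : EuclideanSpace ℝ (Fin d) × ℝ ↦
      u p.1 * fderiv ℝ φ (p.1 + p.2 • v) v)
      (volume.prod (volume.restrict (Ioc (0 : ℝ) 1))) := by
    refine Integrable.mul_bdd (c := B * ‖v‖) (hu.comp_fst _)
      (Continuous.aestronglyMeasurable (by fun_prop)) (.of_forall fun p ↦ ?_)
    exact (ContinuousLinearMap.le_opNorm _ _).trans (by gcongr; exact hB _)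
  have htranslate : ∀ s : ℝ,
      ‖∫ x, u x * fderiv ℝ φ (x + s • v) v‖ₑ ≤ ‖v‖ₑ * totalVariation u := by
    intro s
    simp_rw [← fderiv_comp_add_right (s • v)]
    exact enorm_integral_mul_fderiv_le (hφ.comp (contDiff_id.add contDiff_const))
      (hc.comp_homeomorph (Homeomorph.addRight (s • v))) (fun x ↦ h1 _) v
  calc ‖∫ x, u x * (φ (x + v) - φ x)‖ₑ
      = ‖∫ s in Ioc (0 : ℝ) 1, ∫ x, u x * fderiv ℝ φ (x + s • v) v‖ₑ := by
        simp_rw [sub_eq_setIntegral_fderiv hφ, ← integral_const_mul]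
        rw [integral_integral_swap hint]
    _ ≤ ∫⁻ s in Ioc (0 : ℝ) 1, ‖∫ x, u x * fderiv ℝ φ (x + s • v) v‖ₑ :=
        enorm_integral_le_lintegral_enorm _
    _ ≤ ∫⁻ _ in Ioc (0 : ℝ) 1, ‖v‖ₑ * totalVariation u := lintegral_mono htranslate
    _ = ‖v‖ₑ * totalVariation u := by simp

theorem lintegral_enorm_translate_sub_le (hu : Integrable u) (h : EuclideanSpace ℝ (Fin d)) :
    ∫⁻ x, ‖u (x + h) - u x‖ₑ ≤ ‖h‖ₑ * totalVariation u := by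
  have huh : Integrable fun x ↦ u (x + h) := hu.comp_add_right h
  refine lintegral_enorm_le_of_forall_enorm_integral_mul_le (huh.sub hu) fun φ hφ hc h1 ↦ ?_
  have hbdd : ∀ {k : EuclideanSpace ℝ (Fin d) → ℝ} (v : EuclideanSpace ℝ (Fin d)),
      Integrable k → Integrable fun x ↦ k x * φ (x + v) := fun v hk ↦
    hk.mul_bdd (c := 1) (hφ.continuous.comp (continuous_add_const v)).aestronglyMeasurable
      (.of_forall fun x ↦ h1 _)
  have hshift : ∫ x, u (x + h) * φ x = ∫ x, u x * φ (x + -h) := by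
    simpa using integral_add_right_eq_self (fun x ↦ u x * φ (x + -h)) h
  calc ‖∫ x, (u (x + h) - u x) * φ x‖ₑ = ‖∫ x, u x * (φ (x + -h) - φ x)‖ₑ := by
        simp_rw [sub_mul, mul_sub]
        rw [integral_sub (by simpa using hbdd 0 huh) (by simpa using hbdd 0 hu),
          integral_sub (hbdd (-h) hu) (by simpa using hbdd 0 hu), hshift]
    _ ≤ ‖-h‖ₑ * totalVariation u :=
        enorm_integral_mul_translate_sub_le hu (hφ.of_le (by simp)) hc h1 (-h)
    _ = ‖h‖ₑ * totalVariation u := by rw [enorm_neg]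

end TotalVariation

section FracDeriv

theorem eLpNorm_translate_sub_le {G : Type*} [AddGroup G] [MeasurableSpace G] [MeasurableAdd G]
    {μ : Measure G} [μ.IsAddRightInvariant] {u : G → ℝ} (hu : AEStronglyMeasurable u μ)
    {p : ℝ≥0∞} (hp : 1 ≤ p) (h : G) :
    eLpNorm (fun x ↦ u (x + h) - u x) p μ ≤ 2 * eLpNorm u p μ := by
  have hshift := measurePreserving_add_right μ h
  calc eLpNorm (fun x ↦ u (x + h) - u x) p μ
      ≤ eLpNorm (u ∘ (· + h)) p μ + eLpNorm u p μ :=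
        eLpNorm_sub_le (hu.comp_measurePreserving hshift) hu hp
    _ = 2 * eLpNorm u p μ := by rw [eLpNorm_comp_measurePreserving hu hshift, two_mul]

variable {d : ℕ} {s : ℝ} {u : EuclideanSpace ℝ (Fin d) → ℝ} {S : Set (EuclideanSpace ℝ (Fin d))}

/-- The part of the singular integral `fracDeriv s u x` over the points `x + h` with `h ∈ S`. -/
noncomputable def truncFracDeriv (s : ℝ) (u : EuclideanSpace ℝ (Fin d) → ℝ)
    (S : Set (EuclideanSpace ℝ (Fin d))) (x : EuclideanSpace ℝ (Fin d)) : ℝ≥0∞ :=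
  ∫⁻ h in S, ‖u (x + h) - u x‖ₑ * ENNReal.ofReal (‖h‖ ^ (-((d : ℝ) + s)))

theorem fracDeriv_eq_lintegral_translate (s : ℝ) (u : EuclideanSpace ℝ (Fin d) → ℝ)
    (x : EuclideanSpace ℝ (Fin d)) :
    fracDeriv s u x = ∫⁻ h, ‖u (x + h) - u x‖ₑ * ENNReal.ofReal (‖h‖ ^ (-((d : ℝ) + s))) := by
  rw [fracDeriv, ← lintegral_add_left_eq_self _ x]
  refine lintegral_congr fun h ↦ ?_
  rw [Real.enorm_eq_ofReal_abs, ← ENNReal.ofReal_mul (abs_nonneg _), sub_add_cancel_left, norm_neg,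
    Real.rpow_neg (norm_nonneg h), div_eq_mul_inv, abs_sub_comm]

theorem fracDeriv_eq_truncFracDeriv_add_compl (hS : MeasurableSet S)
    (x : EuclideanSpace ℝ (Fin d)) :
    fracDeriv s u x = truncFracDeriv s u S x + truncFracDeriv s u Sᶜ x := by
  rw [fracDeriv_eq_lintegral_translate, truncFracDeriv, truncFracDeriv, lintegral_add_compl _ hS]

theorem aemeasurable_truncFracDeriv_kernel (s : ℝ) (hu : AEStronglyMeasurable u)
    (S : Set (EuclideanSpace ℝ (Fin d))) :
    AEMeasurable (fun p : EuclideanSpace ℝ (Fin d) × EuclideanSpace ℝ (Fin d) ↦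
      ‖u (p.1 + p.2) - u p.1‖ₑ * ENNReal.ofReal (‖p.2‖ ^ (-((d : ℝ) + s))))
      (volume.prod (volume.restrict S)) := by
  have hadd : Measure.QuasiMeasurePreserving
      (fun p : EuclideanSpace ℝ (Fin d) × EuclideanSpace ℝ (Fin d) ↦ p.1 + p.2)
      (volume.prod (volume.restrict S)) volume := by
    simpa only [add_comm] using
      quasiMeasurePreserving_add_swap (volume : Measure (EuclideanSpace ℝ (Fin d)))
        (volume.restrict S)
  exact ((hu.comp_quasiMeasurePreserving hadd).sub hu.comp_fst).enorm.mul (by fun_prop)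

theorem aemeasurable_truncFracDeriv (s : ℝ) (hu : AEStronglyMeasurable u)
    (S : Set (EuclideanSpace ℝ (Fin d))) : AEMeasurable (truncFracDeriv s u S) :=
  (aemeasurable_truncFracDeriv_kernel s hu S).lintegral_prod_right'

theorem lintegral_truncFracDeriv (hu : AEStronglyMeasurable u) :
    ∫⁻ x, truncFracDeriv s u S x = ∫⁻ h in S,
      (∫⁻ x, ‖u (x + h) - u x‖ₑ) * ENNReal.ofReal (‖h‖ ^ (-((d : ℝ) + s))) := by
  simp only [truncFracDeriv]
  rw [lintegral_lintegral_swap (aemeasurable_truncFracDeriv_kernel s hu S)]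
  exact lintegral_congr fun h ↦ lintegral_mul_const' _ _ ENNReal.ofReal_ne_top

variable [NeZero d] {r : ℝ}

theorem setLIntegral_compl_closedBall_norm_rpow_euclidean (hs : 0 < s) (hr : 0 < r) :
    ∫⁻ h in (Metric.closedBall (0 : EuclideanSpace ℝ (Fin d)) r)ᶜ,
      ENNReal.ofReal (‖h‖ ^ (-((d : ℝ) + s))) =
      (volume : Measure (EuclideanSpace ℝ (Fin d))).toSphere univ *
        ENNReal.ofReal (r ^ (-s) / s) := by
  simpa using setLIntegral_compl_closedBall_norm_rpow
    (volume : Measure (EuclideanSpace ℝ (Fin d))) hs hr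

theorem lintegral_truncFracDeriv_closedBall_le (hu : Integrable u) (hs : s < 1) (hr : 0 < r) :
    ∫⁻ x, truncFracDeriv s u (Metric.closedBall 0 r) x ≤ totalVariation u *
      ((volume : Measure (EuclideanSpace ℝ (Fin d))).toSphere univ *
        ENNReal.ofReal (r ^ (1 - s) / (1 - s))) := by
  have hkernel : ∀ h : EuclideanSpace ℝ (Fin d),
      ‖h‖ₑ * ENNReal.ofReal (‖h‖ ^ (-((d : ℝ) + s))) ≤ ENNReal.ofReal (‖h‖ ^ (1 - s - d)) := by
    intro h
    have hexp : -((d : ℝ) + s) + 1 = 1 - s - d := by ring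
    rcases eq_or_ne h 0 with rfl | hh
    · simp
    · rw [← ofReal_norm, ← ENNReal.ofReal_mul (norm_nonneg h), mul_comm,
        ← Real.rpow_add_one (norm_ne_zero_iff.2 hh), hexp]
  calc ∫⁻ x, truncFracDeriv s u (Metric.closedBall 0 r) x
      ≤ ∫⁻ h in Metric.closedBall (0 : EuclideanSpace ℝ (Fin d)) r,
        ‖h‖ₑ * totalVariation u * ENNReal.ofReal (‖h‖ ^ (-((d : ℝ) + s))) := by
        rw [lintegral_truncFracDeriv hu.1]
        gcongr
        exact lintegral_enorm_translate_sub_le hu _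
    _ ≤ ∫⁻ h in Metric.closedBall (0 : EuclideanSpace ℝ (Fin d)) r,
        totalVariation u * ENNReal.ofReal (‖h‖ ^ (1 - s - d)) := by
        refine lintegral_mono fun h ↦ ?_
        rw [mul_comm ‖h‖ₑ, mul_assoc]
        exact mul_le_mul_right (hkernel h) _
    _ = _ := by
        rw [lintegral_const_mul _ (by fun_prop)]
        simpa using congrArg (totalVariation u * ·) (setLIntegral_closedBall_norm_rpow
          (volume : Measure (EuclideanSpace ℝ (Fin d))) (sub_pos.2 hs) hr)

theorem truncFracDeriv_compl_closedBall_ae_le (hs : 0 < s) (hr : 0 < r)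
    (u : EuclideanSpace ℝ (Fin d) → ℝ) :
    ∀ᵐ x, truncFracDeriv s u (Metric.closedBall 0 r)ᶜ x ≤ 2 * eLpNorm u ∞ *
      ((volume : Measure (EuclideanSpace ℝ (Fin d))).toSphere univ *
        ENNReal.ofReal (r ^ (-s) / s)) := by
  have hbdd : ∀ᵐ x, ‖u x‖ₑ ≤ eLpNorm u ∞ := by
    rw [eLpNorm_exponent_top]
    exact enorm_ae_le_eLpNormEssSup u volume
  filter_upwards [hbdd] with x hx
  have hx' : ∀ᵐ h, ‖u (x + h) - u x‖ₑ ≤ 2 * eLpNorm u ∞ := by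
    filter_upwards [(measurePreserving_add_left volume x).quasiMeasurePreserving.ae hbdd] with h hh
    exact enorm_sub_le.trans ((add_le_add hh hx).trans_eq (two_mul _).symm)
  rw [← setLIntegral_compl_closedBall_norm_rpow_euclidean hs hr,
    ← lintegral_const_mul _ (by fun_prop)]
  refine lintegral_mono_ae ((ae_restrict_of_ae hx').mono fun h hh ↦ ?_)
  gcongr

theorem lintegral_truncFracDeriv_compl_closedBall_le (hu : AEStronglyMeasurable u) (hs : 0 < s)
    (hr : 0 < r) :
    ∫⁻ x, truncFracDeriv s u (Metric.closedBall 0 r)ᶜ x ≤ 2 * eLpNorm u 1 *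
      ((volume : Measure (EuclideanSpace ℝ (Fin d))).toSphere univ *
        ENNReal.ofReal (r ^ (-s) / s)) := by
  rw [lintegral_truncFracDeriv hu, ← setLIntegral_compl_closedBall_norm_rpow_euclidean hs hr,
    ← lintegral_const_mul _ (by fun_prop)]
  gcongr with h
  rw [← eLpNorm_one_eq_lintegral_enorm]
  exact eLpNorm_translate_sub_le hu le_rfl h

theorem lintegral_rearrangement_fracDeriv_le (hu : Integrable u) (hs₀ : 0 < s) (hs₁ : s < 1)
    {t : ℝ} (hr : 0 < r) :
    ∫⁻ τ in Ioc 0 t, rearrangement (fracDeriv s u) τ ≤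
      (volume : Measure (EuclideanSpace ℝ (Fin d))).toSphere univ *
        (totalVariation u * ENNReal.ofReal (r ^ (1 - s) / (1 - s)) +
          2 * min (ENNReal.ofReal t * eLpNorm u ∞) (eLpNorm u 1) *
            ENNReal.ofReal (r ^ (-s) / s)) := by
  have hnear := lintegral_truncFracDeriv_closedBall_le hu hs₁ hr
  have hfar₁ := lintegral_truncFracDeriv_compl_closedBall_le hu.1 hs₀ hr
  have hfar := truncFracDeriv_compl_closedBall_ae_le hs₀ hr u
  have hsplit : fracDeriv s u = truncFracDeriv s u (Metric.closedBall 0 r) +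
      truncFracDeriv s u (Metric.closedBall 0 r)ᶜ :=
    funext <| fracDeriv_eq_truncFracDeriv_add_compl Metric.isClosed_closedBall.measurableSet
  have hmeas := fun S ↦ aemeasurable_truncFracDeriv s hu.1 S
  rcases le_total (ENNReal.ofReal t * eLpNorm u ∞) (eLpNorm u 1) with hle | hle
  · rw [min_eq_left hle, hsplit]
    refine (lintegral_rearrangement_le_add (hmeas _) (hfar.mono fun x hx ↦ add_le_add_right hx _)
      t).trans ((add_le_add_left hnear _).trans_eq (by ring))
  · rw [min_eq_right hle, hsplit]
    refine (lintegral_mono_set Ioc_subset_Ioi_self).trans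
      ((lintegral_rearrangement_le ((hmeas _).add (hmeas _))).trans ?_)
    simp only [Pi.add_apply]
    rw [lintegral_add_left' (hmeas _)]
    exact (add_le_add hnear hfar₁).trans_eq (by ring)

end FracDeriv

section Optimisation

variable {A B F K : ℝ≥0∞} {p q : ℝ}

theorem exists_mul_rpow_div_add_mul_rpow_neg_div_eq (hA₀ : A ≠ 0) (hA : A ≠ ∞) (hB₀ : B ≠ 0)
    (hB : B ≠ ∞) (hp : 0 < p) (hq : 0 < q) :
    ∃ r : ℝ, 0 < r ∧ A * ENNReal.ofReal (r ^ p / p) + B * ENNReal.ofReal (r ^ (-q) / q) =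
      ENNReal.ofReal (1 / p + 1 / q) * (A ^ (q / (p + q)) * B ^ (p / (p + q))) := by
  obtain ⟨a, rfl⟩ : ∃ a, A = ENNReal.ofReal (Real.exp a) :=
    ⟨Real.log A.toReal, by
      rw [Real.exp_log (ENNReal.toReal_pos hA₀ hA), ENNReal.ofReal_toReal hA]⟩
  obtain ⟨b, rfl⟩ : ∃ b, B = ENNReal.ofReal (Real.exp b) :=
    ⟨Real.log B.toReal, by
      rw [Real.exp_log (ENNReal.toReal_pos hB₀ hB), ENNReal.ofReal_toReal hB]⟩
  refine ⟨Real.exp ((b - a) / (p + q)), Real.exp_pos _, ?_⟩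
  have hexpA : a * (q / (p + q)) + b * (p / (p + q)) = a + (b - a) / (p + q) * p := by
    field_simp
    ring
  have hexpB : a * (q / (p + q)) + b * (p / (p + q)) = b + (b - a) / (p + q) * -q := by
    field_simp
    ring
  rw [ENNReal.ofReal_rpow_of_pos (Real.exp_pos a), ENNReal.ofReal_rpow_of_pos (Real.exp_pos b),
    ← ENNReal.ofReal_mul (by positivity), ← ENNReal.ofReal_mul (by positivity),
    ← ENNReal.ofReal_mul (by positivity), ← ENNReal.ofReal_mul (by positivity),
    ← ENNReal.ofReal_add (by positivity) (by positivity)]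
  simp only [← Real.exp_mul, mul_div_assoc', ← Real.exp_add]
  rw [← hexpA, ← hexpB]
  ring_nf

theorem le_mul_rpow_mul_rpow_of_forall_le (hp : 0 < p) (hq : 0 < q) (hA : A ≠ ∞) (hB : B ≠ ∞)
    (hK : K ≠ ∞)
    (hF : ∀ r : ℝ, 0 < r →
      F ≤ K * (A * ENNReal.ofReal (r ^ p / p) + B * ENNReal.ofReal (r ^ (-q) / q))) :
    F ≤ K * (ENNReal.ofReal (1 / p + 1 / q) * (A ^ (q / (p + q)) * B ^ (p / (p + q)))) := by
  -- Perturb `A` and `B`, since the optimal radius `(B / A) ^ (1 / (p + q))` may be `0` or `∞`.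
  have hε : ∀ ε : ℝ≥0, 0 < ε → F ≤ K * (ENNReal.ofReal (1 / p + 1 / q) *
      ((A + ε) ^ (q / (p + q)) * (B + ε) ^ (p / (p + q)))) := by
    intro ε hε
    obtain ⟨r, hr, heq⟩ := exists_mul_rpow_div_add_mul_rpow_neg_div_eq (A := A + ε) (B := B + ε)
      (by simp [hε.ne']) (by simp [hA]) (by simp [hε.ne']) (by simp [hB]) hp hq
    rw [← heq]
    exact (hF r hr).trans (by gcongr <;> exact le_self_add)
  have hlim : ∀ {X : ℝ≥0∞} {θ : ℝ}, Tendsto (fun ε : ℝ≥0 ↦ (X + ε) ^ θ) (𝓝[>] 0) (𝓝 (X ^ θ)) := by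
    intro X θ
    have : Continuous fun ε : ℝ≥0 ↦ (X + ε) ^ θ := by fun_prop
    simpa using this.continuousWithinAt.tendsto (x := 0) (s := Ioi 0)
  refine ge_of_tendsto (x := 𝓝[>] (0 : ℝ≥0)) ?_ (eventually_mem_nhdsWithin.mono hε)
  refine ENNReal.Tendsto.const_mul (ENNReal.Tendsto.const_mul (ENNReal.Tendsto.mul hlim (.inr ?_)
    hlim (.inr ?_)) (.inr ENNReal.ofReal_ne_top)) (.inr hK)
  · exact ENNReal.rpow_ne_top_of_nonneg (by positivity) hB
  · exact ENNReal.rpow_ne_top_of_nonneg (by positivity) hA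

end Optimisation

section Lorentz

theorem lintegral_rpow_mul_min_rpow_le_add {a β : ℝ} (hβ : 0 < β) (hβa : β < a) (M N : ℝ≥0∞)
    {r : ℝ} (hr : 0 < r) :
    ∫⁻ t in Ioi (0 : ℝ), ENNReal.ofReal (t ^ (-β - 1)) * min (ENNReal.ofReal t * M) N ^ a ≤
      M ^ a * ENNReal.ofReal (r ^ (a - β) / (a - β)) +
        N ^ a * ENNReal.ofReal (r ^ (-β) / β) := by
  have ha : 0 < a := hβ.trans hβa
  have hsmall : ∀ t ∈ Ioi (0 : ℝ), ENNReal.ofReal (t ^ (-β - 1)) *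
      min (ENNReal.ofReal t * M) N ^ a ≤ M ^ a * ENNReal.ofReal (t ^ (a - β - 1)) := by
    intro t (ht : 0 < t)
    calc _ ≤ ENNReal.ofReal (t ^ (-β - 1)) * (ENNReal.ofReal t * M) ^ a := by
          gcongr
          exact min_le_left _ _
      _ = M ^ a * ENNReal.ofReal (t ^ (a - β - 1)) := by
          rw [ENNReal.mul_rpow_of_nonneg _ _ ha.le, ENNReal.ofReal_rpow_of_pos ht, ← mul_assoc,
            ← ENNReal.ofReal_mul (by positivity), ← Real.rpow_add ht, mul_comm]
          ring_nf
  have hlarge : ∀ t, ENNReal.ofReal (t ^ (-β - 1)) * min (ENNReal.ofReal t * M) N ^ a ≤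
      N ^ a * ENNReal.ofReal (t ^ (-β - 1)) := by
    intro t
    rw [mul_comm]
    gcongr
    exact min_le_right _ _
  rw [← Ioc_union_Ioi_eq_Ioi hr.le, ← setLIntegral_Ioc_rpow_sub_one (sub_pos.2 hβa) hr,
    ← setLIntegral_Ioi_rpow_neg_sub_one hβ hr, ← lintegral_const_mul _ (by fun_prop),
    ← lintegral_const_mul _ (by fun_prop)]
  exact (lintegral_union_le _ _ _).trans <| add_le_add
    (setLIntegral_mono (by fun_prop) fun t ht ↦ hsmall t ht.1) (lintegral_mono hlarge)

theorem lintegral_rpow_mul_min_rpow_le {a β : ℝ} (hβ : 0 < β) (hβa : β < a) (M : ℝ≥0∞)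
    {N : ℝ≥0∞} (hN : N ≠ ∞) :
    ∫⁻ t in Ioi (0 : ℝ), ENNReal.ofReal (t ^ (-β - 1)) * min (ENNReal.ofReal t * M) N ^ a ≤
      ENNReal.ofReal (1 / (a - β) + 1 / β) * (M ^ β * N ^ (a - β)) := by
  have ha : 0 < a := hβ.trans hβa
  have hβa' : 0 < a - β := sub_pos.2 hβa
  rcases eq_or_ne N 0 with rfl | hN₀
  · simp [ENNReal.zero_rpow_of_pos ha]
  rcases eq_or_ne M ∞ with rfl | hM
  · have hκ : 0 < 1 / (a - β) + 1 / β := by positivity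
    rw [ENNReal.top_rpow_of_pos hβ, ENNReal.top_mul (by simp [hN₀, hN]),
      ENNReal.mul_top (by simpa using hκ)]
    exact le_top
  have hMa : M ^ a ≠ ∞ := ENNReal.rpow_ne_top_of_nonneg ha.le hM
  have hNa : N ^ a ≠ ∞ := ENNReal.rpow_ne_top_of_nonneg ha.le hN
  refine (le_mul_rpow_mul_rpow_of_forall_le hβa' hβ hMa hNa ENNReal.one_ne_top fun r hr ↦
    (lintegral_rpow_mul_min_rpow_le_add hβ hβa M N hr).trans_eq (one_mul _).symm).trans_eq ?_
  rw [one_mul, sub_add_cancel, ← ENNReal.rpow_mul, ← ENNReal.rpow_mul, mul_div_cancel₀ _ ha.ne',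
    mul_div_cancel₀ _ ha.ne']

variable {d : ℕ} {f : EuclideanSpace ℝ (Fin d) → ℝ≥0∞}

theorem lorentzNorm_one_eq (q : ℝ) (f : EuclideanSpace ℝ (Fin d) → ℝ≥0∞) :
    lorentzNorm q 1 f = ∫⁻ t in Ioi (0 : ℝ),
      ENNReal.ofReal (t ^ (-(1 - 1 / q) - 1)) * ∫⁻ s in Ioc 0 t, rearrangement f s := by
  simp only [lorentzNorm, averagedRearrangement, div_one, ENNReal.rpow_one]
  refine setLIntegral_congr_fun measurableSet_Ioi fun t (ht : 0 < t) ↦ ?_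
  have hpow : t ^ (-(1 - 1 / q) - 1) = t ^ (1 / q) * t⁻¹ * t⁻¹ := by
    rw [← Real.rpow_neg_one, ← Real.rpow_add ht, ← Real.rpow_add ht]
    ring_nf
  rw [hpow, ENNReal.ofReal_mul (by positivity), ENNReal.ofReal_mul (by positivity),
    ENNReal.ofReal_inv_of_pos ht, ENNReal.ofReal_rpow_of_pos ht]
  simp only [div_eq_mul_inv]
  ring

theorem lorentzNorm_one_le {a q : ℝ} (hq : 1 < q) (hqa : 1 - 1 / q < a) {K M N : ℝ≥0∞}
    (hN : N ≠ ∞) (hf : ∀ t : ℝ,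
      ∫⁻ s in Ioc 0 t, rearrangement f s ≤ K * min (ENNReal.ofReal t * M) N ^ a) :
    lorentzNorm q 1 f ≤ K * (ENNReal.ofReal (1 / (a - (1 - 1 / q)) + 1 / (1 - 1 / q)) *
      (M ^ (1 - 1 / q) * N ^ (a - (1 - 1 / q)))) := by
  have hβ : 0 < 1 - 1 / q := by
    rw [sub_pos, div_lt_one (by positivity)]
    exact hq
  calc lorentzNorm q 1 f
      ≤ ∫⁻ t in Ioi (0 : ℝ), K * (ENNReal.ofReal (t ^ (-(1 - 1 / q) - 1)) *
          min (ENNReal.ofReal t * M) N ^ a) := by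
        rw [lorentzNorm_one_eq]
        refine lintegral_mono fun t ↦ ?_
        rw [mul_left_comm]
        gcongr
        exact hf t
    _ ≤ _ := by
        rw [lintegral_const_mul _ (by fun_prop)]
        gcongr
        exact lintegral_rpow_mul_min_rpow_le hβ hqa M hN

end Lorentz

theorem lintegral_rearrangement_fracDeriv_one_sub_le {d : ℕ} [NeZero d] {α : ℝ} (hα₀ : 0 < α)
    (hα₁ : α < 1) {u : EuclideanSpace ℝ (Fin d) → ℝ} (hu : IsBV u) (t : ℝ) :
    ∫⁻ τ in Ioc 0 t, rearrangement (fracDeriv (1 - α) u) τ ≤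
      (volume : Measure (EuclideanSpace ℝ (Fin d))).toSphere univ *
        ENNReal.ofReal (1 / α + 1 / (1 - α)) * 2 ^ α * totalVariation u ^ (1 - α) *
          min (ENNReal.ofReal t * eLpNorm u ∞) (eLpNorm u 1) ^ α := by
  have hmin : min (ENNReal.ofReal t * eLpNorm u ∞) (eLpNorm u 1) ≠ ∞ :=
    ((min_le_right _ _).trans_lt (memLp_one_iff_integrable.2 hu.1).eLpNorm_lt_top).ne
  have hsplit := fun r hr ↦ lintegral_rearrangement_fracDeriv_le hu.1 (sub_pos.2 hα₁)
    (sub_lt_self 1 hα₀) (t := t) (r := r) hr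
  rw [sub_sub_cancel] at hsplit
  refine (le_mul_rpow_mul_rpow_of_forall_le hα₀ (sub_pos.2 hα₁) hu.2.ne
    (ENNReal.mul_ne_top ENNReal.ofNat_ne_top hmin) (measure_ne_top _ _) hsplit).trans_eq ?_
  rw [add_sub_cancel, div_one, div_one, ENNReal.mul_rpow_of_nonneg _ _ hα₀.le]
  ring

theorem exists_lorentzNorm_fracDeriv_le (d : ℕ) [NeZero d] {α q : ℝ} (hα : α < 1) (hq : 1 < q)
    (hqα : 1 - 1 / q < α) :
    ∃ C : ℝ≥0, 0 < C ∧ ∀ u : EuclideanSpace ℝ (Fin d) → ℝ, IsBV u →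
      lorentzNorm q 1 (fracDeriv (1 - α) u) ≤ C * totalVariation u ^ (1 - α) *
        eLpNorm u 1 ^ (α - (1 - 1 / q)) * eLpNorm u ∞ ^ (1 - 1 / q) := by
  have hα₀ : 0 < α := lt_trans (sub_pos.2 ((div_lt_one (by positivity)).2 hq)) hqα
  set C : ℝ≥0∞ := (volume : Measure (EuclideanSpace ℝ (Fin d))).toSphere univ *
    ENNReal.ofReal (1 / α + 1 / (1 - α)) * 2 ^ α *
      ENNReal.ofReal (1 / (α - (1 - 1 / q)) + 1 / (1 - 1 / q))
  have hC : C ≠ ∞ := by finiteness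
  refine ⟨C.toNNReal + 1, by positivity, fun u hu ↦ ?_⟩
  calc lorentzNorm q 1 (fracDeriv (1 - α) u)
      ≤ _ := lorentzNorm_one_le hq hqα (memLp_one_iff_integrable.2 hu.1).eLpNorm_ne_top
        (lintegral_rearrangement_fracDeriv_one_sub_le hα₀ hα hu)
    _ = C * totalVariation u ^ (1 - α) * eLpNorm u 1 ^ (α - (1 - 1 / q)) *
        eLpNorm u ∞ ^ (1 - 1 / q) := by ring
    _ ≤ _ := by
        gcongr
        rw [ENNReal.coe_add, ENNReal.coe_toNNReal hC]
        exact le_self_add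

theorem eLpNorm_chi_one_le {d : ℕ} (E : Set (EuclideanSpace ℝ (Fin d))) :
    eLpNorm (chi E) 1 ≤ volume E := by
  simpa [chi] using eLpNorm_indicator_const_le (1 : ℝ) 1 (s := E) (μ := volume)

theorem eLpNorm_chi_top_le_one {d : ℕ} (E : Set (EuclideanSpace ℝ (Fin d))) :
    eLpNorm (chi E) ∞ ≤ 1 := by
  simpa [chi] using eLpNorm_indicator_const_le (1 : ℝ) ∞ (s := E) (μ := volume)

theorem mul_eLpNorm_chi_rpow_mul_le {d : ℕ} (E : Set (EuclideanSpace ℝ (Fin d))) (K : ℝ≥0∞)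
    {a b : ℝ} (ha : 0 ≤ a) (hb : 0 ≤ b) :
    K * eLpNorm (chi E) 1 ^ a * eLpNorm (chi E) ∞ ^ b ≤ K * volume E ^ a :=
  (mul_le_mul' (mul_le_mul_right (ENNReal.rpow_le_rpow (eLpNorm_chi_one_le E) ha) K)
    (ENNReal.rpow_le_one (eLpNorm_chi_top_le_one E) hb)).trans_eq (mul_one _)

end FracPerimeter

theorem lemma1p2_general (d : ℕ) (hd : 2 ≤ d) (α : ℝ) (hα₀ : 0 < α) (hα₁ : α < 1) :
    ∃ C : ℝ≥0, 0 < C ∧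
      ∀ u : EuclideanSpace ℝ (Fin d) → ℝ, FracPerimeter.IsBV u →
        FracPerimeter.lorentzNorm ((d : ℝ) / ((d : ℝ) - α)) 1 (FracPerimeter.fracDeriv (1 - α) u) ≤
          (C : ℝ≥0∞) * FracPerimeter.totalVariation u ^ (1 - α) *
            eLpNorm u 1 ^ (α * (1 - 1 / (d : ℝ))) * eLpNorm u ∞ ^ (α / d) := by
  have : NeZero d := ⟨by omega⟩
  have hd' : (2 : ℝ) ≤ d := by exact_mod_cast hd
  have hdα : 0 < (d : ℝ) - α := by linarith
  have hq : 1 - 1 / ((d : ℝ) / (d - α)) = α / d := by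
    field_simp
    ring
  have hθ : α - α / d = α * (1 - 1 / (d : ℝ)) := by ring
  have hq₁ : 1 < (d : ℝ) / (d - α) := (one_lt_div hdα).2 (by linarith)
  have hqα : 1 - 1 / ((d : ℝ) / (d - α)) < α := hq ▸ div_lt_self hα₀ (by linarith)
  simpa only [hq, hθ] using FracPerimeter.exists_lorentzNorm_fracDeriv_le d hα₁ hq₁ hqα

theorem lemma1p2 (d : ℕ) (hd : 2 ≤ d) (α : ℝ) (hα₀ : 0 < α) (hα₁ : α < 1) :
    ∃ C : ℝ≥0, 0 < C ∧
      ∀ E : Set (EuclideanSpace ℝ (Fin d)), FracPerimeter.HasFinitePerimeter E →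
        FracPerimeter.lorentzNorm ((d : ℝ) / ((d : ℝ) - α)) 1
            (FracPerimeter.fracDeriv (1 - α) (FracPerimeter.chi E)) ≤
          (C : ℝ≥0∞) * FracPerimeter.perimeter E ^ (1 - α) *
            volume E ^ (α * (1 - 1 / (d : ℝ))) := by
  obtain ⟨C, hC, hbound⟩ := lemma1p2_general d hd α hα₀ hα₁
  exact ⟨C, hC, fun E hE ↦ (hbound _ hE.2).trans <| FracPerimeter.mul_eLpNorm_chi_rpow_mul_le E _
    (mul_nonneg hα₀.le (Nat.one_sub_one_div_cast_nonneg d)) (by positivity)⟩
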